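/- **Setting.** There are $n$ agents. Fix a set $S\subseteq\mathbb{R}$ of possible amounts with $0,1\in S$ (for example $S=\{0,1\}$, $S=[0,\infty)$ or $S=\mathbb{R}$) and functions $l,h:\mathbb{N}\to\mathbb{R}$ with $0<l(n)<h(n)$ for all $n$. An input is a valuation vector $\mathbf v\in\{l(n),h(n)\}^n$, an allocation is a vector $\mathbf x\in S^n$, and the welfare of $\mathbf x$ at $\mathbf v$ is $\mathbf v\cdot\mathbf x=\sum_i v_ix_i$. An instance consists of a feasibility set $\mathcal F\subseteq S^n$ that is downward-closed (if $\mathbf x\in\mathcal F$, $\mathbf y\in S^n$ and $y_i\le x_i$ for all $i$, then $\mathbf y\in\mathcal F$) and an algorithm $\mathcal A:\{l(n),h(n)\}^n\to\mathcal F$. A rule $f:\{l(n),h(n)\}^n\to S^n$ is monotone if $f(\mathbf v)_i$ does not decrease when $v_i$ is raised and the other entries of $\mathbf v$ stay fixed. It preserves a fraction $c$ of the welfare of $\mathcal A$ pointwise if $\mathbf v\cdot f(\mathbf v)\ge c\,(\mathbf v\cdot\mathcal A(\mathbf v))$ at every input $\mathbf v$. A deterministic transformation for $n$ agents receives an input $\mathbf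 v$ and adaptively makes queries, each asking either for $\mathcal A(\mathbf w)$ at an input $\mathbf w$ of its choice or whether an allocation $\mathbf x$ of its choice belongs to $\mathcal F$; it then returns an allocation in $S^n$. So on every instance it produces a rule $\mathcal T(\mathcal A)$. A randomized transformation is a (discrete) probability distribution over deterministic transformations, the distribution of its coin tosses. The running time of a transformation is only required to be polynomial in the sense that it makes at most $p(n)$ queries, for a fixed polynomial $p$, for every outcome of the coin tosses, every instance and every input; in particular every polynomial-time transformation qualifies. The transformation may depend on $n$, $l$ and $h$. **Theorem.** Suppose that $h(n)/l(n)\in O(n^\alpha)$ for some $\alpha\in[0,1)$. Then there does not exist a polynomial-time, monotone, constant-fraction welfare-preserving transformation, even if it is randomized, adaptive, and allowed to query $\mathcal F$. Precisely: there do not exist a family, indexed by the number $n$ of agents, of randomized transformations that make at most polynomially many queries, and constants $c>0$ and $\delta>0$ such that for every $n$ and every instance $(\mathcal F,\mathcal A)$ with $n$ agents, with probability at least $\delta$ over the coin tosses, the rule $\mathcal T(\mathcal A)$ takes all its values in $\mathcal F$, is monotone, and preserves a fraction $c$ of the welfare of $\mathcal A$ pointwise. (The case $\delta=1$ is that of transformations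 that are monotone and constant-fraction welfare-preserving for all coin tosses.) -/

import Mathlib

open Filter Asymptotics

noncomputable section

namespace BlackBox

/-- Valuation vectors of `n` agents whose private values lie in `V`. -/
abbrev Valuation (V : Set ℝ) (n : ℕ) : Type := Fin n → V

/-- Allocations to `n` agents; `S` is the set of amounts that an agent can be given
(`{0, 1}` for the usual binary auctions, `Set.univ` for arbitrary real amounts). -/
abbrev Allocation (S : Set ℝ) (n : ℕ) : Type := Fin n → S

/-- An allocation rule: it assigns an allocation to every valuation vector. -/
abbrev AllocationRule (V S : Set ℝ) (n : ℕ) : Type := Valuation V n → Allocation S n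

/-- The social welfare `v ⬝ x` of the allocation `x` at the valuation vector `v`. -/
def welfare {V S : Set ℝ} {n : ℕ} (v : Valuation V n) (x : Allocation S n) : ℝ :=
  ∑ i, (v i : ℝ) * (x i : ℝ)

/-- Decreasing the amounts given to agents keeps an allocation feasible. -/
def DownwardClosed {S : Set ℝ} {n : ℕ} (F : Set (Allocation S n)) : Prop :=
  ∀ x ∈ F, ∀ y : Allocation S n, (∀ i, y i ≤ x i) → y ∈ F

/-- A downward-closed feasibility set together with an algorithm, that is, an allocation rule
all of whose allocations are feasible. -/
structure Instance (V S : Set ℝ) (n : ℕ) where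
  /-- the feasibility set -/
  feasible : Set (Allocation S n)
  downwardClosed : DownwardClosed feasible
  /-- the algorithm to which black-box access is given -/
  alg : AllocationRule V S n
  alg_mem : ∀ v, alg v ∈ feasible

/-- If an agent raises its declared value while the other values stay fixed, then the agent is
allocated at least as much as before. -/
def IsMonotone {V S : Set ℝ} {n : ℕ} (f : AllocationRule V S n) : Prop :=
  ∀ (v : Valuation V n) (i : Fin n) (a : V), v i ≤ a → f v i ≤ f (Function.update v i a) i

/-- The rule `f` obtains at least the fraction `c` of the welfare of `g` at every input. -/
def PreservesFraction {V S : Set ℝ} {n : ℕ} (c : ℝ) (g f : AllocationRule V S n) : Prop :=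
  ∀ v, c * welfare v (g v) ≤ welfare v (f v)

/-- A deterministic adaptive computation with black-box access to an algorithm and to a
feasibility set. It either stops with an allocation, or queries the algorithm at a valuation
vector, or asks whether an allocation is feasible, and continues according to the answer. -/
inductive QueryProgram (V S : Set ℝ) (n : ℕ) : Type
  | output (x : Allocation S n) : QueryProgram V S n
  | queryAlg (w : Valuation V n) (next : Allocation S n → QueryProgram V S n) :
      QueryProgram V S n
  | queryFeasible (x : Allocation S n) (next : Bool → QueryProgram V S n) :
      QueryProgram V S n

open Classical in
/-- The allocation that the computation returns on the instance `I`. -/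
def QueryProgram.run {V S : Set ℝ} {n : ℕ} (I : Instance V S n) :
    QueryProgram V S n → Allocation S n
  | .output x => x
  | .queryAlg w next => (next (I.alg w)).run I
  | .queryFeasible x next => (next (decide (x ∈ I.feasible))).run I

open Classical in
/-- The number of queries (to the algorithm and to the feasibility set) that the computation
makes on the instance `I`. All other computation is free, so this is a lower bound for the
running time of every realization of the computation on a machine with these two oracles. -/
def QueryProgram.numQueries {V S : Set ℝ} {n : ℕ} (I : Instance V S n) :
    QueryProgram V S n → ℕ
  | .output _ => 0
  | .queryAlg w next => (next (I.alg w)).numQueries I + 1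
  | .queryFeasible x next => (next (decide (x ∈ I.feasible))).numQueries I + 1

/-- A deterministic transformation for `n` agents: an adaptive computation for every input. -/
abbrev DetTransformation (V S : Set ℝ) (n : ℕ) : Type := Valuation V n → QueryProgram V S n

/-- The allocation rule `𝒯(𝒜)` that the transformation produces on an instance. -/
def DetTransformation.rule {V S : Set ℝ} {n : ℕ} (τ : DetTransformation V S n)
    (I : Instance V S n) : AllocationRule V S n :=
  fun v => (τ v).run I

/-- A randomized transformation for `n` agents: a probability distribution over deterministic
ones (fixing all coin tosses leaves a deterministic transformation; the coin tosses for
different inputs may be independent or shared). -/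
abbrev Transformation (V S : Set ℝ) (n : ℕ) : Type := PMF (DetTransformation V S n)

/-- Whatever the coin tosses, the instance and the input, the number of queries is at most a
fixed polynomial in the number `n` of agents. -/
def PolynomiallyManyQueries {V : ℕ → Set ℝ} {S : Set ℝ}
    (T : ∀ n, Transformation (V n) S n) : Prop :=
  ∃ p : Polynomial ℕ, ∀ (n : ℕ), ∀ τ ∈ (T n).support,
    ∀ (I : Instance (V n) S n) (v : Valuation (V n) n), (τ v).numQueries I ≤ p.eval n

/-- On the instance `I` the transformation produces a feasible and monotone allocation rule that
preserves the fraction `c` of the welfare of the given algorithm at every input. -/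
def DetTransformation.Succeeds {V S : Set ℝ} {n : ℕ} (τ : DetTransformation V S n)
    (c : ℝ) (I : Instance V S n) : Prop :=
  (∀ v, τ.rule I v ∈ I.feasible) ∧ IsMonotone (τ.rule I) ∧ PreservesFraction c I.alg (τ.rule I)

/-- The probability, over the coin tosses of the transformation, that it succeeds on `I`. -/
def Transformation.successProb {V S : Set ℝ} {n : ℕ} (T : Transformation V S n)
    (c : ℝ) (I : Instance V S n) : ENNReal :=
  PMF.toOuterMeasure T {τ | τ.Succeeds c I}

/-- There are constants `c > 0` and `δ > 0` such that, for every number of agents and every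
instance, with probability at least `δ` the produced allocation rule is feasible and monotone
and preserves the fraction `c` of the welfare at every input. For `δ = 1` this is the property
of being (almost surely) monotone and constant-fraction welfare-preserving. -/
def MonotoneConstantFractionPreserving {V : ℕ → Set ℝ} {S : Set ℝ}
    (T : ∀ n, Transformation (V n) S n) : Prop :=
  ∃ c : ℝ, 0 < c ∧ ∃ δ : ENNReal, 0 < δ ∧
    ∀ (n : ℕ) (I : Instance (V n) S n), δ ≤ (T n).successProb c I

end BlackBox

end

/-!
The hard instances have a set `U₀` of agents and a much larger set `U₁` disjoint from it. Feasible
allocations serve members of `U₀` only, members of `U₁` only, or fewer than `d` agents, where `d`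
is so small that a set of the last kind is worthless in comparison with `U₀`. The algorithm serves
`U₀`, except when the agents of high value are at least `d` members of a set `W ⊆ U₀`; then it
serves `U₁`. The sets `W` and `U₁` are secret: they are what is left of `U₀` and of its complement
when one agent is removed at random from each block of `q` consecutive agents, where `q` is a
constant that is large in terms of `c`.

When all values are low, a transformation with polynomially many queries cannot find `U₁`: for this
it would have to guess `d` agents none of which has been removed, and that succeeds with
probability at most `(1 - 1 / q) ^ (d / q)` per guess (`card_subset_survivors_le`,
`card_run_ne_le`). So its allocation serves a fraction `c` of `U₀`, and since `U₀ \ W` is only a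
fraction `1 / q` of `U₀`, it serves some `u ∈ W`. By monotonicity `u` is still served after its
value is raised, so even if the transformation discovers `U₁` now, it has to serve `U₀` again,
hence another member of `W` of low value. Raising one such agent after the other leads to `d`
high values in `W` and an allocation inside `U₀`, at an input where the algorithm obtains the
welfare of `U₁`, which is far greater (`served_subset_of_succeeds`). This needs that `d` high
values are negligible beside the low values of `U₀`, that is `d * (h n / l n) = o(n)`, and
`h n / l n = O(n ^ α)` leaves room for `d` to be of the order `n ^ ((1 - α) / 2)`, so that the
probability of a good guess is superpolynomially small.

A randomized transformation that succeeds on every instance with probability at least `δ` would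
succeed on an average secret with that probability, and so would one of the deterministic
transformations in its support (`card_mul_le_of_successProb`), which has just been excluded.
-/

namespace BlackBox

variable {V S : Set ℝ} {n : ℕ}

/-! ### Allocations and valuations given by sets of agents -/

/-- The agents that are given a positive amount. Amounts may be negative when `S` is not bounded
below, so this can be smaller than the set of agents with a nonzero amount. -/
noncomputable def served (x : Allocation S n) : Finset (Fin n) :=
  Finset.univ.filter fun i => 0 < (x i : ℝ)

theorem mem_served {x : Allocation S n} {i : Fin n} : i ∈ served x ↔ 0 < (x i : ℝ) := by
  simp [served]

/-- The allocation of the amount `1` to the agents in `U` and `0` to the others. -/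
def serve (hS0 : (0 : ℝ) ∈ S) (hS1 : (1 : ℝ) ∈ S) (U : Finset (Fin n)) : Allocation S n :=
  fun i => if i ∈ U then ⟨1, hS1⟩ else ⟨0, hS0⟩

theorem coe_serve (hS0 : (0 : ℝ) ∈ S) (hS1 : (1 : ℝ) ∈ S) (U : Finset (Fin n)) (i : Fin n) :
    ((serve hS0 hS1 U i : S) : ℝ) = if i ∈ U then 1 else 0 := by
  unfold serve; split_ifs <;> rfl

theorem served_serve (hS0 : (0 : ℝ) ∈ S) (hS1 : (1 : ℝ) ∈ S) (U : Finset (Fin n)) :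
    served (serve hS0 hS1 U) = U := by
  ext i
  rw [mem_served, coe_serve]
  split_ifs with h <;> simp [h]

/-- The agents whose declared value is `b`. -/
noncomputable def highSet (b : ℝ) (v : Valuation V n) : Finset (Fin n) :=
  Finset.univ.filter fun i => (v i : ℝ) = b

/-- The valuation vector with value `b` on `H` and value `a` elsewhere. -/
def highOn (a b : ℝ) (H : Finset (Fin n)) : Valuation {a, b} n :=
  fun i => if i ∈ H then ⟨b, by simp⟩ else ⟨a, by simp⟩

theorem coe_highOn (a b : ℝ) (H : Finset (Fin n)) (i : Fin n) :
    (highOn a b H i : ℝ) = if i ∈ H then b else a := by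
  unfold highOn; split_ifs <;> rfl

theorem highSet_highOn {a b : ℝ} (hab : a < b) (H : Finset (Fin n)) :
    highSet b (highOn a b H) = H := by
  ext i
  simp only [highSet, Finset.mem_filter, Finset.mem_univ, true_and, coe_highOn]
  split_ifs with h <;> simp [h, hab.ne]

theorem update_highOn (a b : ℝ) (H : Finset (Fin n)) (u : Fin n) :
    Function.update (highOn a b H) u ⟨b, by simp⟩ = highOn a b (insert u H) := by
  funext i
  by_cases h : i = u
  · subst h; simp [highOn]
  · simp [highOn, h]

/-! ### Instances with a trap -/

/-- The instance with two big feasible sets of agents, `U₀` and `U₁`: an allocation of amounts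
at most `1` is feasible if the agents served lie in `U₀`, or lie in `U₁`, or are fewer than `d`.
The algorithm serves `U₁` if the agents of high value are at least `d` members of `W`, and `U₀`
otherwise. For `W = U₁ = ∅` and `d > 0` the set `U₁` plays no role. -/
noncomputable def trapInstance (hS0 : (0 : ℝ) ∈ S) (hS1 : (1 : ℝ) ∈ S) (b : ℝ) (d : ℕ)
    (U₀ W U₁ : Finset (Fin n)) : Instance V S n where
  feasible := {x | (∀ i, (x i : ℝ) ≤ 1) ∧
    (served x ⊆ U₀ ∨ (served x).card < d ∨ served x ⊆ U₁)}
  downwardClosed := by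
    rintro x ⟨hx1, hx⟩ y hyx
    have hsub : served y ⊆ served x := fun i hi =>
      mem_served.2 ((mem_served.1 hi).trans_le (hyx i))
    refine ⟨fun i => le_trans (hyx i) (hx1 i), ?_⟩
    rcases hx with hx | hx | hx
    · exact Or.inl (hsub.trans hx)
    · exact Or.inr (Or.inl ((Finset.card_le_card hsub).trans_lt hx))
    · exact Or.inr (Or.inr (hsub.trans hx))
  alg v := serve hS0 hS1 (if d ≤ (highSet b v).card ∧ highSet b v ⊆ W then U₁ else U₀)
  alg_mem v := by
    refine ⟨fun i => ?_, ?_⟩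
    · rw [coe_serve]; split_ifs <;> norm_num
    · rw [served_serve]; split_ifs <;> simp

/-! ### Welfare bounds -/

theorem welfare_serve (hS0 : (0 : ℝ) ∈ S) (hS1 : (1 : ℝ) ∈ S) (v : Valuation V n)
    (U : Finset (Fin n)) : welfare v (serve hS0 hS1 U) = ∑ i ∈ U, (v i : ℝ) := by
  simp [welfare, coe_serve, Finset.sum_ite_mem]

theorem le_welfare_serve (hS0 : (0 : ℝ) ∈ S) (hS1 : (1 : ℝ) ∈ S) {a b : ℝ} (hab : a < b)
    (H U : Finset (Fin n)) : a * U.card ≤ welfare (highOn a b H) (serve hS0 hS1 U) := by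
  rw [welfare_serve, mul_comm, ← nsmul_eq_mul]
  refine Finset.card_nsmul_le_sum _ _ _ fun i _ => ?_
  rw [coe_highOn]; split_ifs <;> linarith

theorem welfare_le_sum_served {a b : ℝ} (ha : 0 < a) (hab : a < b) {H : Finset (Fin n)}
    {x : Allocation S n} (hx : ∀ i, (x i : ℝ) ≤ 1) :
    welfare (highOn a b H) x ≤ ∑ i ∈ served x, (highOn a b H i : ℝ) := by
  rw [welfare, served, Finset.sum_filter]
  refine Finset.sum_le_sum fun i _ => ?_
  have hv : 0 < (highOn a b H i : ℝ) := by rw [coe_highOn]; split_ifs <;> linarith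
  split_ifs with h
  · nlinarith [hx i]
  · nlinarith

theorem welfare_le_card_served {a b : ℝ} (ha : 0 < a) (hab : a < b) {H : Finset (Fin n)}
    {x : Allocation S n} (hx : ∀ i, (x i : ℝ) ≤ 1) :
    welfare (highOn a b H) x ≤ b * (served x).card := by
  refine (welfare_le_sum_served ha hab hx).trans ?_
  rw [mul_comm, ← nsmul_eq_mul]
  refine Finset.sum_le_card_nsmul _ _ _ fun i _ => ?_
  rw [coe_highOn]; split_ifs <;> linarith

theorem welfare_le_of_served_sdiff_subset {a b : ℝ} (ha : 0 < a) (hab : a < b)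
    {H Q : Finset (Fin n)} {x : Allocation S n} (hx : ∀ i, (x i : ℝ) ≤ 1)
    (hQ : served x \ H ⊆ Q) :
    welfare (highOn a b H) x ≤ a * Q.card + b * H.card := by
  have hb : 0 < b := ha.trans hab
  have h1 : ∑ i ∈ served x \ H, (highOn a b H i : ℝ) = a * (served x \ H).card := by
    rw [mul_comm, ← nsmul_eq_mul, ← Finset.sum_const]
    refine Finset.sum_congr rfl fun i hi => ?_
    rw [coe_highOn, if_neg (Finset.mem_sdiff.1 hi).2]
  have h2 : ∑ i ∈ served x ∩ H, (highOn a b H i : ℝ) = b * (served x ∩ H).card := by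
    rw [mul_comm, ← nsmul_eq_mul, ← Finset.sum_const]
    refine Finset.sum_congr rfl fun i hi => ?_
    rw [coe_highOn, if_pos (Finset.mem_inter.1 hi).2]
  have h3 : ((served x \ H).card : ℝ) ≤ Q.card := by exact_mod_cast Finset.card_le_card hQ
  have h4 : ((served x ∩ H).card : ℝ) ≤ H.card := by
    exact_mod_cast Finset.card_le_card Finset.inter_subset_right
  calc _ ≤ ∑ i ∈ served x, (highOn a b H i : ℝ) := welfare_le_sum_served ha hab hx
    _ = a * (served x \ H).card + b * (served x ∩ H).card := by
        rw [← h1, ← h2, add_comm, Finset.sum_inter_add_sum_sdiff]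
    _ ≤ _ := by gcongr

/-! ### Monotone rules on trap instances -/

/-- A rule that succeeds on a trap instance has to serve at least `d` agents of `U₁` already when
all values are low. Otherwise one can raise members of `W` one after the other, each being served
at the time, and the allocation stays inside `U₀`: it has to serve many members of `U₀`, so it
serves some member of `W` of low value, and by monotonicity this agent, which is not in `U₁`, is
still served after its value is raised. As soon as `d` values are high, `U₀` is worth too little
in comparison with `U₁`. -/
theorem served_subset_of_succeeds (hS0 : (0 : ℝ) ∈ S) (hS1 : (1 : ℝ) ∈ S) {a b c : ℝ}
    (ha : 0 < a) (hab : a < b) {d : ℕ} {U₀ W U₁ : Finset (Fin n)} (hW : W ⊆ U₀)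
    (hU : Disjoint U₀ U₁)
    (hU₀ : a * (U₀ \ W).card + b * d < c * (a * U₀.card))
    (hU₁ : a * U₀.card + b * d < c * (a * U₁.card)) (hc : 0 ≤ c)
    {τ : DetTransformation {a, b} S n}
    (hτ : τ.Succeeds c (trapInstance hS0 hS1 b d U₀ W U₁)) :
    let x := τ.rule (trapInstance hS0 hS1 b d U₀ W U₁) (highOn a b ∅)
    d ≤ (served x).card ∧ served x ⊆ U₁ := by
  obtain ⟨hfeas, hmono, hpres⟩ := hτ
  set I : Instance {a, b} S n := trapInstance hS0 hS1 b d U₀ W U₁ with hI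
  intro x
  have hb : 0 < b := ha.trans hab
  by_contra hx
  have hcap : ∀ v i, (τ.rule I v i : ℝ) ≤ 1 := fun v => (hfeas v).1
  have hsmall : ∀ H : Finset (Fin n), (served (τ.rule I (highOn a b H))).card < d →
      welfare (highOn a b H) (τ.rule I (highOn a b H)) ≤ b * d := fun H hH =>
    (welfare_le_card_served ha hab (hcap _)).trans <| by
      have : ((served (τ.rule I (highOn a b H))).card : ℝ) ≤ d := by exact_mod_cast hH.le
      gcongr
  have hlow₀ : ∀ H U : Finset (Fin n), I.alg (highOn a b H) = serve hS0 hS1 U →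
      c * (a * U.card) ≤ welfare (highOn a b H) (τ.rule I (highOn a b H)) := fun H U hHU => by
    refine le_trans ?_ (hpres (highOn a b H))
    rw [hHU]
    gcongr
    exact le_welfare_serve hS0 hS1 hab H U
  have halg : ∀ H : Finset (Fin n), I.alg (highOn a b H) =
      serve hS0 hS1 (if d ≤ H.card ∧ H ⊆ W then U₁ else U₀) := fun H => by
    simp [hI, trapInstance, highSet_highOn hab]
  have chain : ∀ k ≤ d, ∃ H ⊆ W, H.card = k ∧
      ¬ (d ≤ (served (τ.rule I (highOn a b H))).card ∧
        served (τ.rule I (highOn a b H)) ⊆ U₁) := by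
    intro k
    induction k with
    | zero => exact fun _ => ⟨∅, by simp, by simp, hx⟩
    | succ k ih =>
      intro hk
      obtain ⟨H, hHW, hHk, hH⟩ := ih (by omega)
      have hwel := hlow₀ H U₀ (by rw [halg, if_neg (by omega)])
      have hd : d ≤ (served (τ.rule I (highOn a b H))).card := by
        by_contra hd
        have := hsmall H (by omega)
        have : 0 ≤ a * ((U₀ \ W).card : ℝ) := by positivity
        linarith
      have hsub : served (τ.rule I (highOn a b H)) ⊆ U₀ := by
        rcases (hfeas (highOn a b H)).2 with h | h | h
        · exact h
        · omega
        · exact absurd ⟨hd, h⟩ hH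
      -- The members of `W` of low value cannot all be left out: the rest of `U₀` is too small.
      obtain ⟨u, hu, huH, huW⟩ :
          ∃ u ∈ served (τ.rule I (highOn a b H)), u ∉ H ∧ u ∈ W := by
        by_contra! hno
        have h1 := welfare_le_of_served_sdiff_subset (Q := U₀ \ W) ha hab (H := H)
          (hcap (highOn a b H)) (fun i hi => by
            rw [Finset.mem_sdiff] at hi ⊢
            exact ⟨hsub hi.1, hno i hi.1 hi.2⟩)
        have h2 : b * (H.card : ℝ) ≤ b * d := by
          have : (H.card : ℝ) ≤ d := by exact_mod_cast (by omega : H.card ≤ d)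
          gcongr
        linarith
      refine ⟨insert u H, Finset.insert_subset huW hHW, by
        rw [Finset.card_insert_of_notMem huH, hHk], fun hbad => ?_⟩
      have hm := hmono (highOn a b H) u ⟨b, by simp⟩ (by
        change (highOn a b H u : ℝ) ≤ b
        rw [coe_highOn, if_neg huH]; exact hab.le)
      rw [update_highOn] at hm
      exact Finset.disjoint_left.1 hU (hW huW)
        (hbad.2 (mem_served.2 ((mem_served.1 hu).trans_le hm)))
  obtain ⟨H, hHW, hHd, hH⟩ := chain d le_rfl
  have hwel := hlow₀ H U₁ (by rw [halg, if_pos ⟨hHd.ge, hHW⟩])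
  have hpos : 0 ≤ a * (U₀.card : ℝ) := by positivity
  rcases (hfeas (highOn a b H)).2 with h | h | h
  · have := welfare_le_of_served_sdiff_subset (Q := U₀) ha hab (H := H)
      (hcap (highOn a b H)) (Finset.sdiff_subset.trans h)
    rw [hHd] at this
    linarith
  · linarith [hsmall H h]
  · rcases lt_or_ge (served (τ.rule I (highOn a b H))).card d with h' | h'
    · linarith [hsmall H h']
    · exact hH ⟨h', h⟩

/-! ### Query programs and averaging over coin tosses -/

/-- A computation can tell the instances of a finite family from a fixed instance `J` only by a
query that they answer differently, and while this has not happened its queries are those that it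
makes on `J`. -/
theorem card_run_ne_le {Ω : Type*} [Fintype Ω] (I : Ω → Instance V S n) (J : Instance V S n)
    (B : ℝ)
    (halg : ∀ w, (Nat.card {ω | (I ω).alg w ≠ J.alg w} : ℝ) ≤ B)
    (hfeas : ∀ x, (Nat.card {ω | ¬ (x ∈ (I ω).feasible ↔ x ∈ J.feasible)} : ℝ) ≤ B)
    (P : QueryProgram V S n) :
    (Nat.card {ω | P.run (I ω) ≠ P.run J} : ℝ) ≤ P.numQueries J * B := by
  have key : ∀ s t u : Set Ω, s ⊆ t ∪ u → (Nat.card s : ℝ) ≤ Nat.card t + Nat.card u := by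
    intro s t u h
    simp only [Nat.card_coe_set_eq]
    exact_mod_cast (Set.ncard_le_ncard h (Set.toFinite _)).trans (Set.ncard_union_le t u)
  induction P with
  | output x => simp [QueryProgram.run, QueryProgram.numQueries]
  | queryAlg w next ih =>
    refine (key _ {ω | (I ω).alg w ≠ J.alg w}
      {ω | (next (J.alg w)).run (I ω) ≠ (next (J.alg w)).run J} fun ω hω => ?_).trans ?_
    · by_cases h : (I ω).alg w = J.alg w
      · right; simpa [QueryProgram.run, h] using hω
      · exact Or.inl h
    · simp only [QueryProgram.numQueries]
      push_cast
      linarith [halg w, ih (J.alg w)]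
  | queryFeasible x next ih =>
    classical
    refine (key _ {ω | ¬ (x ∈ (I ω).feasible ↔ x ∈ J.feasible)}
      {ω | (next (decide (x ∈ J.feasible))).run (I ω) ≠
        (next (decide (x ∈ J.feasible))).run J} fun ω hω => ?_).trans ?_
    · by_cases h : x ∈ (I ω).feasible ↔ x ∈ J.feasible
      · right; simpa [QueryProgram.run, h] using hω
      · exact Or.inl h
    · simp only [QueryProgram.numQueries]
      push_cast
      linarith [hfeas x, ih (decide (x ∈ J.feasible))]

/-- Yao's averaging argument: if every deterministic transformation in the support succeeds on at
most `M` instances of a finite family, then the success probabilities add up to at most `M`. -/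
theorem card_mul_le_of_successProb {Ω : Type*} [Fintype Ω] (I : Ω → Instance V S n)
    (T : Transformation V S n) (c : ℝ) (δ M : ENNReal)
    (hT : ∀ ω, δ ≤ T.successProb c (I ω))
    (hM : ∀ τ ∈ T.support, (Nat.card {ω | τ.Succeeds c (I ω)} : ENNReal) ≤ M) :
    Fintype.card Ω * δ ≤ M := by
  classical
  calc (Fintype.card Ω : ENNReal) * δ = ∑ _ω : Ω, δ := by simp
    _ ≤ ∑ ω, T.successProb c (I ω) := Finset.sum_le_sum fun ω _ => hT ω
    _ = ∑ ω, ∑' τ, T τ * (if τ.Succeeds c (I ω) then 1 else 0) := by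
        refine Finset.sum_congr rfl fun ω _ => ?_
        rw [Transformation.successProb, PMF.toOuterMeasure_apply]
        refine tsum_congr fun τ => ?_
        simp [Set.indicator_apply]
    _ = ∑' τ, ∑ ω, T τ * (if τ.Succeeds c (I ω) then 1 else 0) :=
        (Summable.tsum_finsetSum fun _ _ => ENNReal.summable).symm
    _ = ∑' τ, T τ * Nat.card {ω | τ.Succeeds c (I ω)} := by
        refine tsum_congr fun τ => ?_
        rw [← Finset.mul_sum]
        simp [Fintype.card_subtype]
    _ ≤ ∑' τ, T τ * M := by
        refine ENNReal.tsum_le_tsum fun τ => ?_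
        by_cases h : τ ∈ T.support
        · gcongr; exact hM τ h
        · rw [PMF.mem_support_iff, not_not] at h
          simp [h]
    _ = M := by rw [ENNReal.tsum_mul_right, T.tsum_coe, one_mul]

/-! ### Random removal of one agent per block -/

/-- The agents that survive when one agent is removed from each block of `q` consecutive agents:
agent `i` lies in the block with number `i / q`, and `ω` tells the removed position in every block.
There are fewer than `n` blocks; the superfluous values of `ω` are ignored. -/
def survivors {n q : ℕ} (ω : Fin n → Fin q) : Finset (Fin n) :=
  Finset.univ.filter fun i => (ω ⟨i / q, (Nat.div_le_self _ _).trans_lt i.2⟩ : ℕ) ≠ i % q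

/-- At most one agent per block is removed. -/
theorem card_le_of_disjoint_survivors {n q : ℕ} (ω : Fin n → Fin q) {Q : Finset (Fin n)} {m : ℕ}
    (hQ : Disjoint Q (survivors ω)) (hm : ∀ i ∈ Q, (i : ℕ) < q * m) : Q.card ≤ m := by
  rw [← Finset.card_range m]
  refine Finset.card_le_card_of_injOn (fun i => (i : ℕ) / q) (fun i hi => ?_)
    fun i hi j hj hij => ?_
  · simpa using Nat.div_lt_of_lt_mul (hm i hi)
  · have rem : ∀ i ∈ Q, (ω ⟨i / q, (Nat.div_le_self _ _).trans_lt i.2⟩ : ℕ) = i % q :=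
      fun i hi => by simpa [survivors] using Finset.disjoint_left.1 hQ hi
    have hij : (i : ℕ) / q = j / q := hij
    have h1 := rem i hi
    have h2 := rem j hj
    simp only [hij] at h1
    ext
    rw [← Nat.div_add_mod (i : ℕ) q, ← Nat.div_add_mod (j : ℕ) q, hij, ← h1, ← h2]

/-- A set of at least `q * k` agents meets at least `k` blocks, so it survives a random removal
with probability at most `(1 - 1 / q) ^ k`. -/
theorem card_subset_survivors_le {n q k : ℕ} (hq : 0 < q) (Q : Finset (Fin n))
    (hQ : q * k ≤ Q.card) :
    (Nat.card {ω : Fin n → Fin q | Q ⊆ survivors ω} : ℝ) ≤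
      Fintype.card (Fin n → Fin q) * (1 - 1 / q : ℝ) ^ k := by
  classical
  let block : Fin n → Fin n := fun i => ⟨i / q, (Nat.div_le_self _ _).trans_lt i.2⟩
  have hq' : (1 : ℝ) ≤ q := by exact_mod_cast hq
  have hρ0 : (0 : ℝ) ≤ 1 - 1 / q := by
    rw [sub_nonneg, div_le_one (by linarith)]; exact hq'
  have hρ1 : (1 - 1 / q : ℝ) ≤ 1 := by
    have : (0 : ℝ) ≤ 1 / q := by positivity
    linarith
  have hblocks : k ≤ (Q.image block).card := by
    have := Finset.card_le_mul_card_image (f := block) Q q fun y _ => by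
      rw [← Finset.card_range q]
      refine Finset.card_le_card_of_injOn (fun i => (i : ℕ) % q)
        (fun i _ => by simpa using Nat.mod_lt _ hq) fun i hi j hj hij => ?_
      have hi' : (i : ℕ) / q = y := congrArg Fin.val (Finset.mem_filter.1 hi).2
      have hj' : (j : ℕ) / q = y := congrArg Fin.val (Finset.mem_filter.1 hj).2
      have hij : (i : ℕ) % q = j % q := hij
      ext
      rw [← Nat.div_add_mod (i : ℕ) q, ← Nat.div_add_mod (j : ℕ) q, hi', hj', hij]
    exact Nat.le_of_mul_le_mul_left (hQ.trans this) hq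
  let allowed : Fin n → Finset (Fin q) := fun y =>
    Finset.univ.filter fun a => ∀ i ∈ Q, block i = y → (a : ℕ) ≠ i % q
  have hset : {ω : Fin n → Fin q | Q ⊆ survivors ω} = (Fintype.piFinset allowed : Set _) := by
    ext ω
    simp only [Set.mem_ofPred_eq, Finset.mem_coe, Fintype.mem_piFinset, allowed,
      Finset.mem_filter, Finset.mem_univ, true_and, Finset.subset_iff, survivors]
    constructor
    · rintro h y i hi rfl
      exact h hi
    · exact fun h i hi => h _ i hi rfl
  have hallowed : ∀ y, ((allowed y).card : ℝ) ≤
      q * if y ∈ Q.image block then (1 - 1 / q : ℝ) else 1 := by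
    intro y
    split_ifs with hy
    · obtain ⟨i, hi, hiy⟩ := Finset.mem_image.1 hy
      have hlt : (allowed y).card < q := by
        refine (Finset.card_lt_card (Finset.ssubset_univ_iff.2 fun h => ?_)).trans_eq
          (Finset.card_fin q)
        have := h ▸ Finset.mem_univ (⟨i % q, Nat.mod_lt _ hq⟩ : Fin q)
        exact (Finset.mem_filter.1 this).2 i hi hiy rfl
      have : ((allowed y).card : ℝ) + 1 ≤ q := by exact_mod_cast hlt
      rw [mul_sub, mul_one_div_cancel (by linarith)]
      linarith
    · have := Finset.card_le_univ (allowed y)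
      rw [Fintype.card_fin] at this
      simpa using this
  rw [hset, Nat.card_coe_set_eq, Set.ncard_coe_finset, Fintype.card_piFinset]
  calc ((∏ y, (allowed y).card : ℕ) : ℝ)
      ≤ ∏ y, ((q : ℝ) * if y ∈ Q.image block then (1 - 1 / q : ℝ) else 1) := by
        rw [Nat.cast_prod]
        exact Finset.prod_le_prod (fun _ _ => by positivity) fun y _ => hallowed y
    _ = Fintype.card (Fin n → Fin q) * (1 - 1 / q : ℝ) ^ (Q.image block).card := by
        rw [Finset.prod_mul_distrib, Finset.prod_ite_mem]
        simp
    _ ≤ _ := by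
        gcongr _ * ?_
        exact pow_le_pow_of_le_one hρ0 hρ1 hblocks

/-! ### Hidden traps -/

/-- The trap instance of size `q ^ 2 * t` hidden by `ω`: `U₀` consists of the first `q * t` agents,
the set `W` of those of them that survive, and `U₁` of the other surviving agents. -/
noncomputable def hiddenTrap {S : Set ℝ} (hS0 : (0 : ℝ) ∈ S) (hS1 : (1 : ℝ) ∈ S) (a b : ℝ)
    (d q t : ℕ) (ω : Fin (q ^ 2 * t) → Fin q) : Instance {a, b} S (q ^ 2 * t) :=
  let U₀ : Finset (Fin (q ^ 2 * t)) := Finset.univ.filter fun i => (i : ℕ) < q * t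
  trapInstance hS0 hS1 b d U₀ (U₀ ∩ survivors ω) (survivors ω \ U₀)

/-- A deterministic transformation with few queries succeeds on few hidden trap instances: on most
of them it computes, at the input with low values only, the same allocation as on the instance
without trap, and this allocation does not fit into the hidden `U₁`. -/
theorem card_succeeds_hiddenTrap_le {S : Set ℝ} (hS0 : (0 : ℝ) ∈ S) (hS1 : (1 : ℝ) ∈ S)
    {a b c : ℝ} (ha : 0 < a) (hab : a < b) {q t k N : ℕ} (hq : 8 ≤ q) (hcq : 8 ≤ c * q)
    (hc : 0 < c) (ht : 0 < t) (hk : 0 < k) (hd : b / a * (q * k : ℕ) ≤ t)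
    (τ : DetTransformation {a, b} S (q ^ 2 * t))
    (hN : ∀ I v, (τ v).numQueries I ≤ N) :
    (Nat.card {ω | τ.Succeeds c (hiddenTrap hS0 hS1 a b (q * k) q t ω)} : ℝ) ≤
      (N + 1) * (Fintype.card (Fin (q ^ 2 * t) → Fin q) * (1 - 1 / q : ℝ) ^ k) := by
  set B : ℝ := Fintype.card (Fin (q ^ 2 * t) → Fin q) * (1 - 1 / q : ℝ) ^ k with hB
  set I := hiddenTrap hS0 hS1 a b (q * k) q t with hI
  set U₀ : Finset (Fin (q ^ 2 * t)) := Finset.univ.filter fun i => (i : ℕ) < q * t with hU₀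
  let J : Instance {a, b} S (q ^ 2 * t) := trapInstance hS0 hS1 b (q * k) U₀ ∅ ∅
  have hq0 : 0 < q := by omega
  have hqk : 0 < q * k := Nat.mul_pos hq0 hk
  have hmono : ∀ s u : Set (Fin (q ^ 2 * t) → Fin q), s ⊆ u →
      (Nat.card s : ℝ) ≤ Nat.card u := by
    intro s u h
    simp only [Nat.card_coe_set_eq]
    exact_mod_cast Set.ncard_le_ncard h (Set.toFinite _)
  have hB0 : 0 ≤ B := by
    have h1 : (1 : ℝ) / q ≤ 1 := by
      rw [div_le_one (by positivity)]; exact_mod_cast hq0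
    have : (0 : ℝ) ≤ 1 - 1 / q := by linarith
    positivity
  -- Whatever reveals a set of `q * k` survivors happens for at most `B` of the `ω`.
  have hrare : ∀ (p : (Fin (q ^ 2 * t) → Fin q) → Prop) (Q : Finset (Fin (q ^ 2 * t))),
      (∀ ω, p ω → q * k ≤ Q.card ∧ Q ⊆ survivors ω) → (Nat.card {ω | p ω} : ℝ) ≤ B := by
    intro p Q hp
    by_cases hQ : q * k ≤ Q.card
    · exact (hmono _ _ fun ω hω => (hp ω hω).2).trans (card_subset_survivors_le hq0 Q hQ)
    · have : {ω | p ω} = ∅ := Set.eq_empty_of_forall_notMem fun ω hω => hQ (hp ω hω).1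
      simpa [this] using hB0
  have halg : ∀ w, (Nat.card {ω | (I ω).alg w ≠ J.alg w} : ℝ) ≤ B := by
    refine fun w => hrare _ (highSet b w) fun ω hω => ?_
    by_contra hno
    refine hω ?_
    simp only [hI, hiddenTrap, J, trapInstance]
    rw [if_neg, if_neg]
    · rintro ⟨h1, h2⟩
      rw [Finset.subset_empty.1 h2] at h1
      simp at h1; omega
    · exact fun h => hno ⟨h.1, h.2.trans Finset.inter_subset_right⟩
  have hfeas : ∀ x, (Nat.card {ω | ¬ (x ∈ (I ω).feasible ↔ x ∈ J.feasible)} : ℝ) ≤ B := by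
    refine fun x => hrare _ (served x) fun ω hω => ?_
    by_contra hno
    refine hω ?_
    simp only [hI, hiddenTrap, J, trapInstance, Set.mem_ofPred_eq]
    refine and_congr_right fun _ => ⟨?_, ?_⟩
    · rintro (h | h | h)
      · exact Or.inl h
      · exact Or.inr (Or.inl h)
      · refine Or.inr (Or.inl (lt_of_not_ge fun h' => hno ⟨h', h.trans Finset.sdiff_subset⟩))
    · rintro (h | h | h)
      · exact Or.inl h
      · exact Or.inr (Or.inl h)
      · exact Or.inl (h.trans (Finset.empty_subset _))
  set x₀ := (τ (highOn a b ∅)).run J with hx₀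
  have hrun := card_run_ne_le I J B halg hfeas (τ (highOn a b ∅))
  have hout : (Nat.card {ω | q * k ≤ (served x₀).card ∧ served x₀ ⊆ survivors ω} : ℝ) ≤ B :=
    hrare _ (served x₀) fun ω hω => hω
  have hNB : ((τ (highOn a b ∅)).numQueries J : ℝ) * B ≤ N * B := by
    have : ((τ (highOn a b ∅)).numQueries J : ℝ) ≤ N := by exact_mod_cast hN J _
    gcongr
  have hunion : {ω | τ.Succeeds c (I ω)} ⊆ {ω | (τ (highOn a b ∅)).run (I ω) ≠ x₀} ∪
      {ω | q * k ≤ (served x₀).card ∧ served x₀ ⊆ survivors ω} := by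
    intro ω hω
    by_cases h : (τ (highOn a b ∅)).run (I ω) = x₀
    · right
      have hcard₀ : U₀.card = q * t := by
        have hle : q * t ≤ q ^ 2 * t := by gcongr; nlinarith
        rw [hU₀, Fin.card_filter_val_lt]
        exact min_eq_right hle
      have hremoved : (U₀ \ (U₀ ∩ survivors ω)).card ≤ t := by
        refine card_le_of_disjoint_survivors ω ?_ fun i hi => ?_
        · rw [Finset.disjoint_left]
          intro i hi hi'
          simp only [Finset.mem_sdiff, Finset.mem_inter] at hi
          exact hi.2 ⟨hi.1, hi'⟩
        · simpa [hU₀] using (Finset.mem_sdiff.1 hi).1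
      have hcard₁ : q ^ 2 * t ≤ (survivors ω \ U₀).card + 2 * (q * t) := by
        have h1 : (Finset.univ \ survivors ω).card ≤ q * t :=
          card_le_of_disjoint_survivors ω Finset.sdiff_disjoint fun i _ => by
            rw [← mul_assoc, ← pow_two]; exact i.2
        have h2 := Finset.card_le_card_sdiff_add_card (s := survivors ω) (t := U₀)
        have h3 := Finset.card_le_card_sdiff_add_card (s := Finset.univ) (t := survivors ω)
        rw [Finset.card_univ, Fintype.card_fin] at h3
        omega
      have hq' : (8 : ℝ) ≤ q := by exact_mod_cast hq
      have ht' : (0 : ℝ) < t := by exact_mod_cast ht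
      have hcard₁' : (q : ℝ) ^ 2 * t - 2 * (q * t) ≤ (survivors ω \ U₀).card := by
        have : (q : ℝ) ^ 2 * t ≤ (survivors ω \ U₀).card + 2 * (q * t) := by exact_mod_cast hcard₁
        linarith
      have hremoved' : ((U₀ \ (U₀ ∩ survivors ω)).card : ℝ) ≤ t := by exact_mod_cast hremoved
      have hd' : b * (q * k : ℕ) ≤ a * t := by
        have := mul_le_mul_of_nonneg_left hd ha.le
        rwa [← mul_assoc, mul_div_cancel₀ _ ha.ne'] at this
      have hat : 0 < a * t := by positivity
      have hqt : 8 * (a * t) ≤ q * (a * t) := by gcongr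
      have hres := served_subset_of_succeeds hS0 hS1 ha hab (W := U₀ ∩ survivors ω)
        (U₁ := survivors ω \ U₀) (d := q * k) Finset.inter_subset_left Finset.disjoint_sdiff
        (by
          rw [hcard₀]
          have h1 : a * ((U₀ \ (U₀ ∩ survivors ω)).card : ℝ) ≤ a * t := by gcongr
          have h2 : 8 * (a * t) ≤ c * q * (a * t) := by gcongr
          push_cast at hd' ⊢
          linarith)
        (by
          rw [hcard₀]
          have h1 : c * (a * ((q : ℝ) ^ 2 * t - 2 * (q * t))) ≤
              c * (a * (survivors ω \ U₀).card) := by gcongr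
          have h2 : 8 * (q - 2) * (a * t) ≤ c * q * (q - 2) * (a * t) := by
            have : (0 : ℝ) ≤ q - 2 := by linarith
            gcongr
          push_cast at hd' ⊢
          linarith)
        hc.le hω
      have hx : τ.rule (I ω) (highOn a b ∅) = x₀ := h
      exact ⟨(hx ▸ hres.1 :), (hx ▸ hres.2 : served x₀ ⊆ _).trans Finset.sdiff_subset⟩
    · exact Or.inl h
  calc _ ≤ (Nat.card ({ω | (τ (highOn a b ∅)).run (I ω) ≠ x₀} ∪
        {ω | q * k ≤ (served x₀).card ∧ served x₀ ⊆ survivors ω} : Set _) : ℝ) :=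
        hmono _ _ hunion
    _ ≤ (Nat.card {ω | (τ (highOn a b ∅)).run (I ω) ≠ x₀} : ℝ) +
        Nat.card {ω | q * k ≤ (served x₀).card ∧ served x₀ ⊆ survivors ω} := by
        simp only [Nat.card_coe_set_eq]
        exact_mod_cast Set.ncard_union_le _ _
    _ ≤ (N + 1) * B := by linarith

/-! ### Growth of the parameters -/

/-- A polynomial is negligible in comparison with the inverse of `ρ ^ t ^ β`. -/
theorem tendsto_polynomial_mul_pow_ceil_rpow (p : Polynomial ℕ) (m : ℕ) {ρ β : ℝ} (hρ0 : 0 < ρ)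
    (hρ1 : ρ < 1) (hβ : 0 < β) :
    Tendsto (fun t : ℕ => ((p.eval (m * t) : ℕ) + 1 : ℝ) * ρ ^ ⌈(t : ℝ) ^ β⌉₊) atTop
      (nhds 0) := by
  have hb : 0 < -Real.log ρ := neg_pos.2 (Real.log_neg hρ0 hρ1)
  have hmono : ∀ e : ℕ, Tendsto (fun t : ℕ => (t : ℝ) ^ e * ρ ^ ⌈(t : ℝ) ^ β⌉₊) atTop
      (nhds 0) := by
    intro e
    have h := (tendsto_rpow_mul_exp_neg_mul_atTop_nhds_zero (e / β) _ hb).comp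
      ((tendsto_rpow_atTop hβ).comp tendsto_natCast_atTop_atTop)
    refine squeeze_zero (fun t => by positivity) (fun t => ?_) h
    simp only [Function.comp_apply]
    have h0 : (0 : ℝ) ≤ t := by positivity
    rw [← Real.rpow_mul h0, mul_div_cancel₀ _ hβ.ne', Real.rpow_natCast, neg_neg,
      ← Real.rpow_def_of_pos hρ0]
    gcongr
    rw [← Real.rpow_natCast]
    exact Real.rpow_le_rpow_of_exponent_ge hρ0 hρ1.le (Nat.le_ceil _)
  have hsum : ∀ t : ℕ, ((p.eval (m * t) : ℕ) + 1 : ℝ) * ρ ^ ⌈(t : ℝ) ^ β⌉₊ =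
      (∑ e ∈ p.support, (p.coeff e * (m : ℝ) ^ e) * ((t : ℝ) ^ e * ρ ^ ⌈(t : ℝ) ^ β⌉₊)) +
        (t : ℝ) ^ 0 * ρ ^ ⌈(t : ℝ) ^ β⌉₊ := by
    intro t
    rw [Polynomial.eval_eq_sum, Polynomial.sum_def]
    push_cast
    rw [add_mul, Finset.sum_mul]
    congr 1
    exact Finset.sum_congr rfl fun e _ => by rw [mul_pow]; ring
  simp only [hsum]
  have := (tendsto_finsetSum p.support fun e _ =>
    (hmono e).const_mul (p.coeff e * (m : ℝ) ^ e)).add (hmono 0)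
  simpa using this

/-- If `g n = O(n ^ α)` with `α < 1`, then `g (m * t) * t ^ ((1 - α) / 2) = o(t)`. -/
theorem eventually_mul_ceil_rpow_le {g : ℕ → ℝ} {α : ℝ} (hα1 : α < 1)
    (hg0 : ∀ n, 0 ≤ g n)
    (hg : g =O[atTop] fun n : ℕ => (n : ℝ) ^ α) {m : ℕ} (hm : 0 < m) (q : ℕ) :
    ∀ᶠ t : ℕ in atTop, g (m * t) * (q * ⌈(t : ℝ) ^ ((1 - α) / 2)⌉₊ : ℕ) ≤ t := by
  set β := (1 - α) / 2 with hβ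
  have hβ0 : 0 < β := by rw [hβ]; linarith
  obtain ⟨C, hC0, hC⟩ := hg.exists_pos
  have hmt : Tendsto (fun t : ℕ => m * t) atTop atTop :=
    tendsto_id.const_mul_atTop' hm
  have hbig : Tendsto (fun t : ℕ => (t : ℝ) ^ β) atTop atTop :=
    (tendsto_rpow_atTop hβ0).comp tendsto_natCast_atTop_atTop
  filter_upwards [hmt.eventually hC.bound, hbig.eventually_ge_atTop (C * m ^ α * (q * 2)),
    eventually_ge_atTop 1] with t h1 h2 h3
  have ht : (1 : ℝ) ≤ t := by exact_mod_cast h3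
  have ht0 : (0 : ℝ) < t := by linarith
  have hceil : (⌈(t : ℝ) ^ β⌉₊ : ℝ) ≤ 2 * (t : ℝ) ^ β := by
    have := Nat.ceil_lt_add_one (a := (t : ℝ) ^ β) (by positivity)
    have := Real.one_le_rpow ht hβ0.le
    linarith
  have hgt : g (m * t) ≤ C * (m ^ α * t ^ α) := by
    rw [Real.norm_of_nonneg (hg0 _), Real.norm_of_nonneg (by positivity)] at h1
    push_cast at h1
    rwa [Real.mul_rpow (by positivity) (by positivity)] at h1
  push_cast
  calc g (m * t) * (q * ⌈(t : ℝ) ^ β⌉₊)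
      ≤ C * (m ^ α * t ^ α) * (q * (2 * (t : ℝ) ^ β)) := by gcongr
    _ = C * m ^ α * (q * 2) * (t ^ α * (t : ℝ) ^ β) := by ring
    _ ≤ (t : ℝ) ^ β * (t ^ α * (t : ℝ) ^ β) := by gcongr
    _ = t := by
      rw [← Real.rpow_add ht0, ← Real.rpow_add ht0]
      have : β + (α + β) = 1 := by rw [hβ]; ring
      rw [this, Real.rpow_one]

end BlackBox

/-! ### Impossibility of the transformation -/

theorem theorem3 (S : Set ℝ) (hS0 : (0 : ℝ) ∈ S) (hS1 : (1 : ℝ) ∈ S)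
    (l h : ℕ → ℝ) (hl : ∀ n, 0 < l n) (hlh : ∀ n, l n < h n)
    (α : ℝ) (hα0 : 0 ≤ α) (hα1 : α < 1)
    (hO : (fun n : ℕ => h n / l n) =O[atTop] (fun n : ℕ => (n : ℝ) ^ α)) :
    ¬ ∃ T : ∀ n : ℕ, BlackBox.Transformation {l n, h n} S n,
        BlackBox.PolynomiallyManyQueries T ∧
        BlackBox.MonotoneConstantFractionPreserving T := by
  rintro ⟨T, ⟨p, hp⟩, c, hc, δ, hδ, hT⟩
  obtain ⟨q, hq⟩ := exists_nat_ge (max 8 (8 / c))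
  have hq8 : 8 ≤ q := by exact_mod_cast (le_max_left _ _).trans hq
  have hq8' : (8 : ℝ) ≤ q := by exact_mod_cast hq8
  have hcq : 8 ≤ c * q := by
    have := (le_max_right _ _).trans hq
    rwa [div_le_iff₀' hc] at this
  obtain ⟨hρ0, hρ1⟩ : (0 : ℝ) < 1 / q ∧ (1 : ℝ) / q < 1 :=
    ⟨by positivity, by rw [div_lt_one (by linarith)]; linarith⟩
  -- `δ` may be infinite, so it is cut off before passing to real numbers.
  obtain ⟨ε, hε0, hεδ⟩ : ∃ ε : NNReal, 0 < ε ∧ (ε : ENNReal) ≤ δ := by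
    obtain ⟨ε, h1, h2⟩ := ENNReal.lt_iff_exists_nnreal_btwn.1 hδ
    exact ⟨ε, by exact_mod_cast h1, h2.le⟩
  have hlarge := BlackBox.eventually_mul_ceil_rpow_le hα1
    (fun n => (div_pos ((hl n).trans (hlh n)) (hl n)).le) hO (m := q ^ 2) (by positivity) q
  have hsmall := (BlackBox.tendsto_polynomial_mul_pow_ceil_rpow p (q ^ 2) (ρ := 1 - 1 / q)
    (β := (1 - α) / 2) (by linarith) (by linarith) (by linarith)).eventually_lt_const
    (show (0 : ℝ) < ε from hε0)
  obtain ⟨t, h1, h2, ht⟩ := (hlarge.and (hsmall.and (eventually_gt_atTop 0))).exists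
  set n := q ^ 2 * t with hn
  set k := ⌈(t : ℝ) ^ ((1 - α) / 2)⌉₊ with hk
  have hk0 : 0 < k := Nat.ceil_pos.2 (by positivity)
  -- `M` bounds the number of secrets for which a deterministic transformation can succeed.
  set M : ℝ := (p.eval n + 1) * (Fintype.card (Fin n → Fin q) * (1 - 1 / q : ℝ) ^ k) with hM
  have hcount := BlackBox.card_mul_le_of_successProb
    (BlackBox.hiddenTrap hS0 hS1 (l n) (h n) (q * k) q t) (T n) c ε (ENNReal.ofReal M)
    (fun ω => hεδ.trans (hT n _)) fun τ hτ => by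
      rw [← ENNReal.ofReal_natCast]
      exact ENNReal.ofReal_le_ofReal (BlackBox.card_succeeds_hiddenTrap_le hS0 hS1 (hl n) (hlh n)
        hq8 hcq hc ht hk0 h1 τ (hp n τ hτ))
  have : NeZero q := ⟨by omega⟩
  have hcard : (0 : ℝ) < Fintype.card (Fin n → Fin q) := by exact_mod_cast Fintype.card_pos
  have hM0 : 0 ≤ M := by
    have : (0 : ℝ) ≤ 1 - 1 / q := by linarith
    positivity
  rw [← ENNReal.ofReal_natCast, ← ENNReal.ofReal_coe_nnreal,
    ← ENNReal.ofReal_mul (by positivity), ENNReal.ofReal_le_ofReal_iff hM0] at hcount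
  have hlt := mul_lt_mul_of_pos_left h2 hcard
  have : M = Fintype.card (Fin n → Fin q) * ((p.eval n + 1) * (1 - 1 / q : ℝ) ^ k) := by
    rw [hM]; ring
  linarith
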